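/- For integers $n\ge 0$ and $k\ge 1$ let the Kneser graph $K(n,k)$ be the graph whose vertices are the $k$-element subsets of $\{1,\dots,n\}$, two of them being adjacent if and only if they are disjoint. The achromatic number $\alpha(G)$ of a finite simple graph $G$ is the largest integer $l\ge 0$ for which there is a surjective map $\varsigma\colon V(G)\to\{1,\dots,l\}$ that is a proper coloring (adjacent vertices receive different colors) and complete (for any two different colors $i,j\in\{1,\dots,l\}$ there is an edge $xy$ of $G$ with $\varsigma(x)=i$ and $\varsigma(y)=j$). Theorem. For every integer $n\ge 0$ with $n\neq 3$, $$\alpha(K(n,2))=\left\lfloor \binom{n+1}{2}\Big/3\right\rfloor,$$ and $\alpha(K(3,2))=1$. -/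

import Mathlib

/-- The Kneser graph `K(n,k)`: its vertices are the `k`-element subsets of an `n`-element set, and
two distinct vertices are adjacent iff the subsets are disjoint.  (For `k ≥ 1` disjoint
`k`-subsets are automatically distinct.) -/
def kneserGraph (n k : ℕ) : SimpleGraph {s : Finset (Fin n) // s.card = k} where
  Adj s t := s ≠ t ∧ Disjoint s.1 t.1
  symm := ⟨fun _ _ h => ⟨h.1.symm, h.2.symm⟩⟩
  loopless := ⟨fun _ h => h.1 rfl⟩

/-- A colouring is complete if any two different colours appear on the ends of some edge. -/
def IsCompleteColoring {V C : Type*} (G : SimpleGraph V) (c : V → C) : Prop :=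
  ∀ i j : C, i ≠ j → ∃ x y : V, G.Adj x y ∧ c x = i ∧ c y = j

/-- `G` has a complete proper `l`-colouring.  All `l` colours are used (surjectivity), and
`G.Coloring` is Mathlib's type of proper colourings. -/
def HasCompleteProperColoring {V : Type*} (G : SimpleGraph V) (l : ℕ) : Prop :=
  ∃ c : G.Coloring (Fin l), Function.Surjective c ∧ IsCompleteColoring G c

/-- `a` is the achromatic number of `G`: the largest `l` for which `G` has a complete proper
`l`-colouring (the maximum is attained). -/
def IsAchromaticNumber {V : Type*} (G : SimpleGraph V) (a : ℕ) : Prop :=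
  IsGreatest {l : ℕ | HasCompleteProperColoring G l} a

/-! Regard a colouring of `K(n,2)` as a colouring of the edges of the complete graph on `n` points:
proper means that edges of one colour pairwise meet, complete means that any two colours own
disjoint edges.

Upper bound: call a point common to a colour if all edges of that colour contain it. Completeness
makes the sets of common points of different colours disjoint, and a class with one edge has two
common points, a class with two edges has one. So edges plus common points number at least 3 per
colour, and `3 * l ≤ n.choose 2 + n`.

Lower bound: the bound is nearly attained when every class is a triangle, a path of length two or a
single edge. Two paths of different colours with different centres contain disjoint edges, so for
triangles and paths completeness reduces to choosing distinct centres. For `n ≡ 1 (mod 3)` a cyclic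
construction works. For `n ≡ 0, 2 (mod 6)` a point is deleted from a Steiner triple system on `n +
1` points; for `n ≡ 3, 5 (mod 6)` two points are added to one on `n - 2` points. The Bose and Skolem
constructions supply the systems. -/

/-! ### The upper bound -/

/-- The vertices common to all edges of a given colour. -/
def commonVertices {n l : ℕ} (c : (kneserGraph n 2).Coloring (Fin l)) (i : Fin l) :
    Finset (Fin n) :=
  Finset.univ.filter fun v => ∀ s, c s = i → v ∈ s.1

theorem commonVertices_disjoint {n l : ℕ} {c : (kneserGraph n 2).Coloring (Fin l)}
    (hc : IsCompleteColoring (kneserGraph n 2) c) {i j : Fin l} (hij : i ≠ j) :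
    Disjoint (commonVertices c i) (commonVertices c j) := by
  rw [Finset.disjoint_left]
  intro v hi hj
  simp only [commonVertices, Finset.mem_filter, Finset.mem_univ, true_and] at hi hj
  obtain ⟨x, y, hxy, hx, hy⟩ := hc i j hij
  exact Finset.disjoint_left.1 hxy.2 (hi x hx) (hj y hy)

/-- Both ends of a lone edge are common, and two edges of one colour share a point by properness. -/
theorem three_le_card_fiber_add_card_commonVertices {n l : ℕ}
    {c : (kneserGraph n 2).Coloring (Fin l)} (hs : Function.Surjective c) (i : Fin l) :
    3 ≤ (Finset.univ.filter fun s => c s = i).card + (commonVertices c i).card := by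
  set F := Finset.univ.filter fun s => c s = i with hF
  have hmem : ∀ s, s ∈ F ↔ c s = i := by simp [hF]
  obtain ⟨s, hsi⟩ := hs i
  have hpos : 0 < F.card := Finset.card_pos.2 ⟨s, (hmem s).2 hsi⟩
  by_contra! hlt
  rcases (by omega : F.card = 1 ∨ F.card = 2 ∨ 3 ≤ F.card) with h1 | h2 | h3
  · obtain ⟨t, ht⟩ := Finset.card_eq_one.1 h1
    have hsub : t.1 ⊆ commonVertices c i := by
      intro v hv
      simp only [commonVertices, Finset.mem_filter, Finset.mem_univ, true_and]
      intro u hu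
      rw [← hmem, ht, Finset.mem_singleton] at hu
      rwa [hu]
    have := Finset.card_le_card hsub
    rw [t.2] at this
    omega
  · obtain ⟨t, u, htu, htu'⟩ := Finset.card_eq_two.1 h2
    have ht : c t = i := by rw [← hmem, htu']; simp
    have hu : c u = i := by rw [← hmem, htu']; simp
    have hnd : ¬ Disjoint t.1 u.1 := fun hd =>
      c.valid (show (kneserGraph n 2).Adj t u from ⟨htu, hd⟩) (ht.trans hu.symm)
    obtain ⟨v, hvt, hvu⟩ := Finset.not_disjoint_iff.1 hnd
    have hv : v ∈ commonVertices c i := by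
      simp only [commonVertices, Finset.mem_filter, Finset.mem_univ, true_and]
      intro w hw
      rw [← hmem, htu', Finset.mem_insert, Finset.mem_singleton] at hw
      rcases hw with rfl | rfl <;> assumption
    have := Finset.card_pos.2 ⟨v, hv⟩
    omega
  · omega

theorem HasCompleteProperColoring.three_mul_le {n l : ℕ}
    (h : HasCompleteProperColoring (kneserGraph n 2) l) : 3 * l ≤ (n + 1).choose 2 := by
  obtain ⟨c, hs, hc⟩ := h
  have h1 : ∑ i : Fin l, 3 ≤ ∑ i : Fin l, ((Finset.univ.filter fun s => c s = i).card +
      (commonVertices c i).card) :=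
    Finset.sum_le_sum fun i _ => three_le_card_fiber_add_card_commonVertices hs i
  have h2 : ∑ i : Fin l, (Finset.univ.filter fun s => c s = i).card = n.choose 2 := by
    rw [← Finset.card_eq_sum_card_fiberwise (f := c) (t := Finset.univ) (by simp)]
    simp [Fintype.card_finset_len]
  have h3 : ∑ i : Fin l, (commonVertices c i).card ≤ n := by
    rw [← Finset.card_biUnion fun i _ j _ hij => commonVertices_disjoint hc hij]
    exact (Finset.card_le_univ _).trans (by simp)
  rw [Finset.sum_add_distrib, h2] at h1
  simp only [Finset.sum_const, Finset.card_univ, Fintype.card_fin, smul_eq_mul] at h1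
  have h4 : (n + 1).choose 2 = n + n.choose 2 := by
    rw [Nat.choose_succ_succ' n 1, Nat.choose_one_right]
  omega

/-! ### Pair colourings and paths of length two -/

/-- A colouring of the edges of the complete graph on `V`, given on ordered pairs, that is proper
and complete as a colouring of the Kneser graph `K(V, 2)`. -/
structure IsCompletePairColoring {V C : Type*} (f : V → V → C) : Prop where
  symm : ∀ x y, f x y = f y x
  proper : ∀ x y u v, x ≠ y → u ≠ v → f x y = f u v → x = u ∨ x = v ∨ y = u ∨ y = v
  complete : ∀ x y u v, x ≠ y → u ≠ v → f x y ≠ f u v →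
    ∃ x' y' u' v', x' ≠ y' ∧ u' ≠ v' ∧ x' ≠ u' ∧ x' ≠ v' ∧ y' ≠ u' ∧ y' ≠ v' ∧
      f x' y' = f x y ∧ f u' v' = f u v

theorem IsCompletePairColoring.comp_equiv {U V C : Type*} {f : V → V → C}
    (h : IsCompletePairColoring f) (e : U ≃ V) :
    IsCompletePairColoring fun x y => f (e x) (e y) where
  symm x y := h.symm _ _
  proper x y u v hxy huv hf := by
    simpa using h.proper _ _ _ _ (e.injective.ne hxy) (e.injective.ne huv) hf
  complete x y u v hxy huv hf := by
    obtain ⟨x', y', u', v', h1, h2, h3, h4, h5, h6, h7, h8⟩ :=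
      h.complete _ _ _ _ (e.injective.ne hxy) (e.injective.ne huv) hf
    refine ⟨e.symm x', e.symm y', e.symm u', e.symm v', ?_⟩
    simp [*]

/-- Only colours in the range are kept, so `C` may contain unused ones; `S` merely certifies how
many are used. -/
theorem IsCompletePairColoring.exists_coloring {n : ℕ} {C : Type*} {f : Fin n → Fin n → C}
    (h : IsCompletePairColoring f) (S : Finset C) (hS : ∀ i ∈ S, ∃ x y, x ≠ y ∧ f x y = i) :
    ∃ l, S.card ≤ l ∧ HasCompleteProperColoring (kneserGraph n 2) l := by
  classical
  have hex : ∀ s : {s : Finset (Fin n) // s.card = 2}, ∃ x y, x ≠ y ∧ s.1 = {x, y} :=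
    fun s => Finset.card_eq_two.1 s.2
  choose a b hab hsab using hex
  let g : {s : Finset (Fin n) // s.card = 2} → C := fun s => f (a s) (b s)
  have hg : ∀ x y (hxy : x ≠ y), g ⟨{x, y}, Finset.card_pair hxy⟩ = f x y := by
    intro x y hxy
    have h1 := hsab ⟨{x, y}, Finset.card_pair hxy⟩
    have h2 := hab ⟨{x, y}, Finset.card_pair hxy⟩
    have h3 := h.symm x y
    change f _ _ = _
    generalize a ⟨{x, y}, Finset.card_pair hxy⟩ = p at *
    generalize b ⟨{x, y}, Finset.card_pair hxy⟩ = q at *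
    simp only [Finset.ext_iff, Finset.mem_insert, Finset.mem_singleton] at h1
    have hp := h1 p
    have hq := h1 q
    grind
  let R : Finset C := Finset.univ.image g
  have hgR : ∀ s, g s ∈ R := fun s => Finset.mem_image_of_mem g (Finset.mem_univ s)
  let e : R ≃ Fin R.card := R.equivFin
  have hvalid : ∀ {s t}, (kneserGraph n 2).Adj s t → e ⟨g s, hgR s⟩ ≠ e ⟨g t, hgR t⟩ := by
    intro s t hst heq
    have heq' : f (a s) (b s) = f (a t) (b t) := congrArg Subtype.val (e.injective heq)
    have hd := hst.2
    rw [hsab s, hsab t] at hd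
    have := h.proper _ _ _ _ (hab s) (hab t) heq'
    simp only [Finset.disjoint_insert_left, Finset.mem_insert, Finset.mem_singleton,
      Finset.disjoint_singleton_left] at hd
    tauto
  refine ⟨R.card, Finset.card_le_card ?_, SimpleGraph.Coloring.mk _ hvalid, ?_, ?_⟩
  · intro i hi
    obtain ⟨x, y, hxy, rfl⟩ := hS i hi
    rw [← hg x y hxy]
    exact hgR _
  · intro i
    obtain ⟨s, -, hs⟩ := Finset.mem_image.1 (e.symm i).2
    refine ⟨s, ?_⟩
    change e ⟨g s, hgR s⟩ = i
    rw [← e.eq_symm_apply]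
    exact Subtype.ext hs
  · intro i j hij
    obtain ⟨s, -, hs⟩ := Finset.mem_image.1 (e.symm i).2
    obtain ⟨t, -, ht⟩ := Finset.mem_image.1 (e.symm j).2
    have hne : f (a s) (b s) ≠ f (a t) (b t) := by
      intro heq
      exact hij (e.symm.injective (Subtype.ext (hs.symm.trans (heq.trans ht))))
    obtain ⟨x, y, u, v, hxy, huv, h1, h2, h3, h4, h5, h6⟩ :=
      h.complete _ _ _ _ (hab s) (hab t) hne
    have hd : Disjoint ({x, y} : Finset (Fin n)) {u, v} := by
      simp [h1.symm, h2.symm, h3.symm, h4.symm]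
    refine ⟨⟨{x, y}, Finset.card_pair hxy⟩, ⟨{u, v}, Finset.card_pair huv⟩, ⟨?_, hd⟩, ?_, ?_⟩
    · intro heq
      have := congrArg Subtype.val heq
      simp only at this
      rw [this] at hd
      simp at hd
    · change e ⟨g _, _⟩ = i
      rw [← e.eq_symm_apply]
      exact Subtype.ext ((hg x y hxy).trans (h5.trans hs))
    · change e ⟨g _, _⟩ = j
      rw [← e.eq_symm_apply]
      exact Subtype.ext ((hg u v huv).trans (h6.trans ht))

/-- The upper bound already caps the number of colours, so exhibiting enough of them suffices; the
slack 2 in `hcard` is the largest remainder modulo 3. -/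
theorem IsCompletePairColoring.isAchromaticNumber {n : ℕ} {V C : Type*} [Fintype V]
    {f : V → V → C} (h : IsCompletePairColoring f) (hn : Fintype.card V = n) (S : Finset C)
    (hS : ∀ i ∈ S, ∃ x y, x ≠ y ∧ f x y = i) (hcard : (n + 1).choose 2 ≤ 3 * S.card + 2) :
    IsAchromaticNumber (kneserGraph n 2) ((n + 1).choose 2 / 3) := by
  let e : Fin n ≃ V := (Fintype.equivFinOfCardEq hn).symm
  obtain ⟨l, hl, hcol⟩ := (h.comp_equiv e).exists_coloring S fun i hi => by
    obtain ⟨x, y, hxy, hf⟩ := hS i hi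
    exact ⟨e.symm x, e.symm y, by simpa using hxy, by simpa using hf⟩
  have hle := hcol.three_mul_le
  have hl' : l = (n + 1).choose 2 / 3 := by omega
  refine ⟨hl' ▸ hcol, fun k hk => ?_⟩
  have := HasCompleteProperColoring.three_mul_le hk
  omega

/-- Two paths of length two without a common edge and with different centres contain disjoint
edges, one from each. -/
theorem exists_disjoint_pairs_of_cherries {V C : Type*} {f : V → V → C}
    (hf : ∀ x y, f x y = f y x) {i j : C} (hij : i ≠ j) {b x y b' x' y' : V} (hb : b ≠ b')
    (hx : b ≠ x) (hy : b ≠ y) (hxy : x ≠ y) (hx' : b' ≠ x') (hy' : b' ≠ y') (hxy' : x' ≠ y')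
    (h1 : f b x = i) (h2 : f b y = i) (h3 : f b' x' = j) (h4 : f b' y' = j) :
    ∃ p q u v, p ≠ q ∧ u ≠ v ∧ p ≠ u ∧ p ≠ v ∧ q ≠ u ∧ q ≠ v ∧ f p q = i ∧ f u v = j := by
  -- If all edges met across, each edge of the second path would contain `b` or be `{x, y}`. Not
  -- both contain `b`, as `b ≠ b'`, and not both are `{x, y}`. In the mixed case `b'` is `x` or `y`,
  -- and the edge `{b, b'}` has both colours.
  by_contra! H
  have e1 := fun p q r => H b x b' x' hx hx' hb p q r h1 h3
  have e2 := fun p q r => H b x b' y' hx hy' hb p q r h1 h4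
  have e3 := fun p q r => H b y b' x' hy hx' hb p q r h2 h3
  have e4 := fun p q r => H b y b' y' hy hy' hb p q r h2 h4
  have s1 := hf b b'
  clear H hf
  grind +splitImp

/-- The vertex `b` is the centre of a path of length two whose edges have colour `i`. -/
def IsCherryCenter {V C : Type*} (f : V → V → C) (i : C) (b : V) : Prop :=
  ∃ x y, b ≠ x ∧ b ≠ y ∧ x ≠ y ∧ f b x = i ∧ f b y = i

theorem IsCherryCenter.exists_disjoint_pairs {V C : Type*} {f : V → V → C}
    (hf : ∀ x y, f x y = f y x) {i j : C} (hij : i ≠ j) {b b' : V} (hb : b ≠ b')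
    (hi : IsCherryCenter f i b) (hj : IsCherryCenter f j b') :
    ∃ p q u v, p ≠ q ∧ u ≠ v ∧ p ≠ u ∧ p ≠ v ∧ q ≠ u ∧ q ≠ v ∧ f p q = i ∧ f u v = j := by
  obtain ⟨x, y, hx, hy, hxy, h1, h2⟩ := hi
  obtain ⟨x', y', hx', hy', hxy', h3, h4⟩ := hj
  exact exists_disjoint_pairs_of_cherries hf hij hb hx hy hxy hx' hy' hxy' h1 h2 h3 h4

/-! ### A colouring for `n = 3m + 1` -/

theorem zmod_three_cases (i j : ZMod 3) : j = i ∨ j = i + 1 ∨ i = j + 1 := by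
  revert i j; decide

theorem zmod_three_add_one_ne (i : ZMod 3) : i + 1 ≠ i := by
  revert i; decide

theorem zmod_three_add_one_add_one_ne (i : ZMod 3) : i + 1 + 1 ≠ i := by
  revert i; decide

/-- The colouring of the edges on `ℤ/m × ℤ/3` together with a point at infinity whose colour
classes are the triangles `{(x, i), (y, i), (x + y, i + 1)}` for `x ≠ y` and the paths
`∞, (x, i), (2x, i + 1)`. -/
def cyclicColoring (m : ℕ) : Option (ZMod m × ZMod 3) → Option (ZMod m × ZMod 3) →
    Sym2 (ZMod m) × ZMod 3
  | none, none => (s(0, 0), 0)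
  | none, some (x, i) => (s(x, x), i)
  | some (x, i), none => (s(x, x), i)
  | some (x, i), some (y, j) =>
    if i = j then (s(x, y), i) else if j = i + 1 then (s(x, y - x), i) else (s(y, x - y), j)

theorem cyclicColoring_symm {m : ℕ} (u v : Option (ZMod m × ZMod 3)) :
    cyclicColoring m u v = cyclicColoring m v u := by
  rcases u with _ | ⟨x, i⟩ <;> rcases v with _ | ⟨y, j⟩ <;> try rfl
  rcases zmod_three_cases i j with rfl | rfl | rfl
  · simp [cyclicColoring, Sym2.eq_swap]
  · have := zmod_three_add_one_ne i
    have := (zmod_three_add_one_add_one_ne i).symm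
    simp [cyclicColoring, *]
  · have := zmod_three_add_one_ne j
    have := (zmod_three_add_one_add_one_ne j).symm
    simp [cyclicColoring, *]

/-- The first alternative covers the edges at infinity, which lie in no triangle. In either form,
two edges of one colour meet. -/
theorem cyclicColoring_eq {m : ℕ} {u v : Option (ZMod m × ZMod 3)} (huv : u ≠ v) {x y : ZMod m}
    {i : ZMod 3} (h : cyclicColoring m u v = (s(x, y), i)) :
    (x = y ∧ (u = some (x, i) ∨ v = some (x, i))) ∨
      (u = some (x, i) ∨ u = some (y, i) ∨ u = some (x + y, i + 1)) ∧
      (v = some (x, i) ∨ v = some (y, i) ∨ v = some (x + y, i + 1)) := by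
  rcases u with _ | ⟨a, k⟩ <;> rcases v with _ | ⟨b, l⟩
  · exact absurd rfl huv
  · simp only [cyclicColoring, Prod.mk.injEq, Sym2.eq_iff] at h
    grind
  · simp only [cyclicColoring, Prod.mk.injEq, Sym2.eq_iff] at h
    grind
  · rcases zmod_three_cases k l with rfl | rfl | rfl
    · simp only [cyclicColoring, Prod.mk.injEq, Sym2.eq_iff, if_true] at h
      grind
    · have h1 := zmod_three_add_one_ne k
      simp only [cyclicColoring, h1.symm, if_false, if_true, Prod.mk.injEq, Sym2.eq_iff] at h
      grind
    · have h1 := zmod_three_add_one_ne l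
      have h2 := zmod_three_add_one_add_one_ne l
      simp only [cyclicColoring, h1, h2.symm, if_false, Prod.mk.injEq, Sym2.eq_iff] at h
      grind

theorem cyclicColoring_center {m : ℕ} (x y : ZMod m) (i : ZMod 3) :
    IsCherryCenter (cyclicColoring m) (s(x, y), i) (some (x, i)) := by
  have h1 := zmod_three_add_one_ne i
  by_cases hxy : x = y
  · subst hxy
    exact ⟨none, some (x + x, i + 1), by simp, by simp, by simp, by simp [cyclicColoring],
      by simp [cyclicColoring]⟩
  · exact ⟨some (y, i), some (x + y, i + 1), by simpa using hxy, by simp,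
      by simp, by simp [cyclicColoring], by simp [cyclicColoring]⟩

theorem isCompletePairColoring_cyclicColoring (m : ℕ) :
    IsCompletePairColoring (cyclicColoring m) where
  symm := cyclicColoring_symm
  proper u v u' v' h h' heq := by
    rcases hc : cyclicColoring m u v with ⟨s, i⟩
    induction s with | _ x y
    have h1 := cyclicColoring_eq h hc
    have h2 := cyclicColoring_eq h' (heq.symm.trans hc)
    grind
  complete u v u' v' h h' hne := by
    rcases hc : cyclicColoring m u v with ⟨s, i⟩
    rcases hc' : cyclicColoring m u' v' with ⟨s', j⟩
    rw [hc, hc'] at hne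
    induction s with | _ x y
    induction s' with | _ x' y'
    -- `(x, i)` and `(y, i)` are both centres for the first colour; if the first centres of two
    -- distinct colours agree, the second ones differ.
    by_cases hxx : (x, i) = (x', j)
    · have hyy : (y, i) ≠ (y', j) := by
        rintro hyy
        simp_all
      have c1 := cyclicColoring_center y x i
      have c2 := cyclicColoring_center y' x' j
      rw [Sym2.eq_swap] at c1 c2
      exact IsCherryCenter.exists_disjoint_pairs cyclicColoring_symm hne (by simpa using hyy) c1 c2
    · exact IsCherryCenter.exists_disjoint_pairs cyclicColoring_symm hne (by simpa using hxx)
        (cyclicColoring_center x y i) (cyclicColoring_center x' y' j)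

theorem isAchromaticNumber_kneserGraph_of_mod_three {m : ℕ} (hm : m ≠ 0) :
    IsAchromaticNumber (kneserGraph (3 * m + 1) 2) ((3 * m + 1 + 1).choose 2 / 3) := by
  have : NeZero m := ⟨hm⟩
  refine (isCompletePairColoring_cyclicColoring m).isAchromaticNumber (by simp [mul_comm])
    Finset.univ ?_ ?_
  · rintro ⟨s, i⟩ -
    induction s with | _ x y
    obtain ⟨p, -, hp, -, -, h, -⟩ := cyclicColoring_center x y i
    exact ⟨_, p, hp, h⟩
  -- With `m * (m + 1) = 2 * k` there are `3 * k` colours, while the binomial coefficient is `9 * k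
  -- + 1`.
  · rw [Finset.card_univ, Fintype.card_prod, Sym2.card, ZMod.card, ZMod.card]
    obtain ⟨k, hk⟩ := Nat.even_mul_succ_self m
    rw [Nat.choose_two_right, Nat.choose_two_right]
    simp only [Nat.add_sub_cancel]
    have h2 : (3 * m + 1 + 1) * (3 * m + 1) = 9 * (k + k) + 2 := by rw [← hk]; ring
    rw [h2, mul_comm (m + 1) m, hk]
    omega

/-! ### Steiner triple systems -/

/-- A Steiner quasigroup: the algebraic form of a Steiner triple system with the blocks
`{x, y, T x y}` for `x ≠ y`. -/
structure IsSteinerOp {W : Type*} (T : W → W → W) : Prop where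
  idem : ∀ x, T x x = x
  comm : ∀ x y, T x y = T y x
  invol : ∀ x y, T x (T x y) = y

/-- The block through two points. -/
def steinerBlock {W : Type*} [DecidableEq W] (T : W → W → W) (x y : W) : Finset W :=
  {x, y, T x y}

namespace IsSteinerOp

variable {W : Type*} {T : W → W → W}

theorem ne_left (h : IsSteinerOp T) {x y : W} (hxy : x ≠ y) : T x y ≠ x := by
  intro he
  have := h.invol x y
  rw [he, h.idem] at this
  exact hxy this

theorem ne_right (h : IsSteinerOp T) {x y : W} (hxy : x ≠ y) : T x y ≠ y := by
  rw [h.comm]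
  exact h.ne_left hxy.symm

variable [DecidableEq W]

theorem block_comm (h : IsSteinerOp T) (x y : W) : steinerBlock T x y = steinerBlock T y x := by
  rw [steinerBlock, steinerBlock, h.comm x y, Finset.insert_comm]

theorem block_eq (h : IsSteinerOp T) {x y u v : W} (huv : u ≠ v)
    (hu : u ∈ steinerBlock T x y) (hv : v ∈ steinerBlock T x y) :
    steinerBlock T u v = steinerBlock T x y := by
  have h1 := h.comm x y
  have h2 := h.invol x y
  have h3 := h.invol y x
  have h4 := h.comm x (T x y)
  have h5 := h.comm y (T x y)
  simp only [steinerBlock, Finset.mem_insert, Finset.mem_singleton] at *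
  ext z
  simp only [Finset.mem_insert, Finset.mem_singleton]
  rcases hu with rfl | rfl | rfl <;> rcases hv with rfl | rfl | rfl <;> grind

theorem card_block (h : IsSteinerOp T) {x y : W} (hxy : x ≠ y) :
    (steinerBlock T x y).card = 3 :=
  Finset.card_eq_three.2 ⟨x, y, T x y, hxy, (h.ne_left hxy).symm, (h.ne_right hxy).symm, rfl⟩

theorem exists_pair_avoiding (h : IsSteinerOp T) {x y : W} (hxy : x ≠ y) (p : W) :
    ∃ u v, u ≠ v ∧ u ≠ p ∧ v ≠ p ∧ u ∈ steinerBlock T x y ∧ v ∈ steinerBlock T x y := by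
  have h1 := h.card_block hxy
  have h2 := Finset.pred_card_le_card_erase (s := steinerBlock T x y) (a := p)
  obtain ⟨u, hu, v, hv, huv⟩ := Finset.one_lt_card.1
    (show 1 < ((steinerBlock T x y).erase p).card by omega)
  rw [Finset.mem_erase] at hu hv
  exact ⟨u, v, huv, hu.1, hv.1, hu.2, hv.2⟩

theorem common_unique (h : IsSteinerOp T) {x y u v p q : W}
    (hne : steinerBlock T x y ≠ steinerBlock T u v) (hp : p ∈ steinerBlock T x y)
    (hp' : p ∈ steinerBlock T u v) (hq : q ∈ steinerBlock T x y) (hq' : q ∈ steinerBlock T u v) :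
    p = q := by
  by_contra hpq
  exact hne ((h.block_eq hpq hp hq).symm.trans (h.block_eq hpq hp' hq'))

/-- The blocks of a Steiner triple system. -/
def blocks [Fintype W] (T : W → W → W) : Finset (Finset W) :=
  (Finset.univ : Finset W).offDiag.image fun p => steinerBlock T p.1 p.2

theorem mem_blocks [Fintype W] {B : Finset W} :
    B ∈ blocks T ↔ ∃ x y, x ≠ y ∧ steinerBlock T x y = B := by
  simp [blocks]

/-- Each block arises from at most six ordered pairs of distinct points. -/
theorem card_mul_le [Fintype W] (h : IsSteinerOp T) :
    Fintype.card W * (Fintype.card W - 1) ≤ 6 * (blocks T).card := by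
  have h1 := Finset.card_le_mul_card_image (f := fun p : W × W => steinerBlock T p.1 p.2)
    (Finset.univ : Finset W).offDiag 6 ?_
  · rw [Finset.offDiag_card, Finset.card_univ] at h1
    rwa [Nat.mul_sub_one]
  · intro B hB
    obtain ⟨x, y, hxy, rfl⟩ := mem_blocks.1 hB
    have h2 : (steinerBlock T x y).offDiag.card = 6 := by
      rw [Finset.offDiag_card, h.card_block hxy]
    rw [← h2]
    apply Finset.card_le_card
    rintro ⟨u, v⟩ huv
    simp only [Finset.mem_filter, Finset.mem_offDiag, Finset.mem_univ, true_and] at huv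
    rw [Finset.mem_offDiag, ← huv.2]
    simp [steinerBlock, huv.1]

theorem exists_disjoint_pairs_avoiding (h : IsSteinerOp T) (p : W) {x y u v : W} (hxy : x ≠ y)
    (huv : u ≠ v) (hne : steinerBlock T x y ≠ steinerBlock T u v) :
    ∃ a b c d, a ≠ b ∧ c ≠ d ∧ a ≠ c ∧ a ≠ d ∧ b ≠ c ∧ b ≠ d ∧ a ≠ p ∧ b ≠ p ∧ c ≠ p ∧ d ≠ p ∧
      a ∈ steinerBlock T x y ∧ b ∈ steinerBlock T x y ∧ c ∈ steinerBlock T u v ∧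
      d ∈ steinerBlock T u v := by
  have hcu := fun r s => h.common_unique (p := r) (q := s) hne
  generalize hB : steinerBlock T x y = B at *
  generalize hB' : steinerBlock T u v = B' at *
  -- Distinct blocks meet in at most one point `q`; if they are disjoint, `p` serves as `q`.
  -- Removing `p` from one block and `q` from the other leaves disjoint pairs avoiding `p`.
  obtain ⟨q, hq⟩ : ∃ q, ∀ r, r ∈ B → r ∈ B' → r = q := by
    by_cases hex : ∃ q, q ∈ B ∧ q ∈ B'
    · obtain ⟨q, hq, hq'⟩ := hex
      exact ⟨q, fun r hr hr' => hcu r q hr hr' hq hq'⟩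
    · exact ⟨p, fun r hr hr' => (hex ⟨r, hr, hr'⟩).elim⟩
  have key : ∀ r s, (r = q ∨ s = q) → (p ∈ B → p = r) → (p ∈ B' → p = s) →
      ∃ a b c d, a ≠ b ∧ c ≠ d ∧ a ≠ c ∧ a ≠ d ∧ b ≠ c ∧ b ≠ d ∧ a ≠ p ∧ b ≠ p ∧
        c ≠ p ∧ d ≠ p ∧ a ∈ B ∧ b ∈ B ∧ c ∈ B' ∧ d ∈ B' := by
    intro r s hrs hr hs
    obtain ⟨a, b, hab, har, hbr, ha, hb⟩ := h.exists_pair_avoiding hxy r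
    obtain ⟨c, d, hcd, hcs, hds, hc, hd⟩ := h.exists_pair_avoiding huv s
    rw [hB] at ha hb
    rw [hB'] at hc hd
    refine ⟨a, b, c, d, hab, hcd, ?_, ?_, ?_, ?_, ?_, ?_, ?_, ?_, ha, hb, hc, hd⟩ <;> grind
  by_cases hp : p ∈ B
  · refine key p q ?_ ?_ ?_ <;> grind
  · refine key q p ?_ ?_ ?_ <;> grind

/-- Blocks through `p` shrink to single edges, which have no centre, so disjoint pairs are found
directly in the blocks. -/
theorem isCompletePairColoring_compl_singleton (h : IsSteinerOp T) (p : W) :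
    IsCompletePairColoring fun x y : {w : W // w ≠ p} => steinerBlock T x.1 y.1 where
  symm x y := h.block_comm _ _
  proper x y u v hxy huv heq := by
    have h1 : u.1 ∈ steinerBlock T x.1 y.1 := by rw [heq]; simp [steinerBlock]
    have h2 : v.1 ∈ steinerBlock T x.1 y.1 := by rw [heq]; simp [steinerBlock]
    simp only [steinerBlock, Finset.mem_insert, Finset.mem_singleton] at h1 h2
    simp only [ne_eq, Subtype.ext_iff] at *
    grind
  complete x y u v hxy huv hne := by
    obtain ⟨a, b, c, d, hab, hcd, h1, h2, h3, h4, ha, hb, hc, hd, h5, h6, h7, h8⟩ :=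
      h.exists_disjoint_pairs_avoiding p (Subtype.coe_ne_coe.2 hxy) (Subtype.coe_ne_coe.2 huv) hne
    refine ⟨⟨a, ha⟩, ⟨b, hb⟩, ⟨c, hc⟩, ⟨d, hd⟩, ?_⟩
    simp only [ne_eq, Subtype.mk.injEq]
    exact ⟨hab, hcd, h1, h2, h3, h4, h.block_eq hab h5 h6, h.block_eq hcd h7 h8⟩

/-- Deleting a point from a Steiner triple system on `n + 1` points. -/
theorem isAchromaticNumber_of_card_succ [Fintype W] (h : IsSteinerOp T) {n : ℕ}
    (hn : Fintype.card W = n + 1) :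
    IsAchromaticNumber (kneserGraph n 2) ((n + 1).choose 2 / 3) := by
  obtain ⟨p⟩ : Nonempty W := Fintype.card_pos_iff.1 (by omega)
  refine (h.isCompletePairColoring_compl_singleton p).isAchromaticNumber ?_ (blocks T) ?_ ?_
  · rw [Fintype.card_subtype_compl, Fintype.card_subtype_eq, hn, Nat.add_sub_cancel]
  · intro B hB
    obtain ⟨x, y, hxy, rfl⟩ := mem_blocks.1 hB
    obtain ⟨u, v, huv, hu, hv, hu', hv'⟩ := h.exists_pair_avoiding hxy p
    exact ⟨⟨u, hu⟩, ⟨v, hv⟩, by simpa using huv, h.block_eq huv hu' hv'⟩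
  · have := h.card_mul_le
    rw [hn] at this
    rw [Nat.choose_two_right]
    omega

/-! ### Adding two points to a Steiner triple system -/

/-- The colouring on a Steiner triple system with two additional points `∞₁, ∞₂`. The colour
classes are the blocks other than the block `{a, b, T a b}`, the paths `∞₁, v, ∞₂` for `v` outside
this block, and five paths with distinct centres on `{a, b, T a b, ∞₁, ∞₂}`. -/
def addTwoColoring (T : W → W → W) (a b : W) : W ⊕ Bool → W ⊕ Bool → Finset W ⊕ (W ⊕ Bool)
  | .inl x, .inl y =>
    if steinerBlock T x y = steinerBlock T a b then
      if x = a ∨ y = a then .inr (.inl a) else .inr (.inl b)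
    else .inl (steinerBlock T x y)
  | .inl x, .inr k =>
    if x = a then .inr (.inr k) else if x = b ∧ k = true then .inr (.inr k) else .inr (.inl x)
  | .inr k, .inl x =>
    if x = a then .inr (.inr k) else if x = b ∧ k = true then .inr (.inr k) else .inr (.inl x)
  | .inr _, .inr _ => .inr (.inr false)

theorem addTwoColoring_symm (h : IsSteinerOp T) (a b : W) (u v : W ⊕ Bool) :
    addTwoColoring T a b u v = addTwoColoring T a b v u := by
  rcases u with x | k <;> rcases v with y | l <;> try rfl
  simp only [addTwoColoring, h.block_comm x y, or_comm]

theorem addTwoColoring_eq_inr {a b : W} (hab : a ≠ b) {u v w : W ⊕ Bool}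
    (huv : u ≠ v) (huvw : addTwoColoring T a b u v = .inr w) : u = w ∨ v = w := by
  rcases u with x | k <;> rcases v with y | l
  · have hxy : x ≠ y := fun he => huv (he ▸ rfl)
    simp only [addTwoColoring] at huvw
    by_cases hB : steinerBlock T x y = steinerBlock T a b
    · have hx : x ∈ steinerBlock T a b := by rw [← hB]; simp [steinerBlock]
      have hy : y ∈ steinerBlock T a b := by rw [← hB]; simp [steinerBlock]
      simp only [steinerBlock, Finset.mem_insert, Finset.mem_singleton] at hx hy
      grind
    · simp [hB] at huvw
  · simp only [addTwoColoring] at huvw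
    grind
  · simp only [addTwoColoring] at huvw
    grind
  · cases k <;> cases l <;> simp_all [addTwoColoring]

theorem addTwoColoring_eq_inl {a b : W} {u v : W ⊕ Bool} {B : Finset W}
    (huv : addTwoColoring T a b u v = .inl B) :
    ∃ x y, u = .inl x ∧ v = .inl y ∧ steinerBlock T x y = B ∧ B ≠ steinerBlock T a b := by
  rcases u with x | k <;> rcases v with y | l <;> simp only [addTwoColoring] at huv
  · refine ⟨x, y, rfl, rfl, ?_⟩
    grind
  all_goals grind

theorem addTwoColoring_center_inr (h : IsSteinerOp T) {a b : W} (hab : a ≠ b) (w : W ⊕ Bool) :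
    IsCherryCenter (addTwoColoring T a b) (.inr w) w := by
  have hca := h.ne_left hab
  have hcb := h.ne_right hab
  have hba := h.block_comm b a
  have hac : steinerBlock T a (T a b) = steinerBlock T a b :=
    h.block_eq hca.symm (by simp [steinerBlock]) (by simp [steinerBlock])
  have hbc : steinerBlock T b (T a b) = steinerBlock T a b :=
    h.block_eq hcb.symm (by simp [steinerBlock]) (by simp [steinerBlock])
  rcases w with v | k
  · by_cases hva : v = a
    · subst hva
      exact ⟨.inl b, .inl (T v b), by simpa using hab, by simpa using hca.symm,
        by simpa using hcb.symm, by simp [addTwoColoring], by simp [addTwoColoring, hac]⟩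
    by_cases hvb : v = b
    · subst hvb
      exact ⟨.inl (T a v), .inr false, by simpa using hcb.symm, by simp, by simp,
        by simp [addTwoColoring, hbc, hab.symm, hca], by simp [addTwoColoring, hab.symm]⟩
    · exact ⟨.inr false, .inr true, by simp, by simp, by simp, by simp [addTwoColoring, hva],
        by simp [addTwoColoring, hva, hvb]⟩
  · cases k
    · exact ⟨.inr true, .inl a, by simp, by simp, by simp, by simp [addTwoColoring],
        by simp [addTwoColoring]⟩
    · exact ⟨.inl a, .inl b, by simp, by simp, by simpa using hab, by simp [addTwoColoring],
        by simp [addTwoColoring]⟩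

/-- A triangle has all three points as centres, which leaves room to avoid the centre of another
colour. -/
theorem addTwoColoring_center_inl (h : IsSteinerOp T) {a b x y z : W} (hxy : x ≠ y)
    (hne : steinerBlock T x y ≠ steinerBlock T a b) (hz : z ∈ steinerBlock T x y) :
    IsCherryCenter (addTwoColoring T a b) (.inl (steinerBlock T x y)) (.inl z) := by
  obtain ⟨u, v, huv, hu, hv, hu', hv'⟩ := h.exists_pair_avoiding hxy z
  have h1 := h.block_eq hu.symm hz hu'
  have h2 := h.block_eq hv.symm hz hv'
  exact ⟨.inl u, .inl v, by simpa using hu.symm, by simpa using hv.symm, by simpa using huv,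
    by simp [addTwoColoring, h1, hne], by simp [addTwoColoring, h2, hne]⟩

theorem isCompletePairColoring_addTwoColoring (h : IsSteinerOp T) {a b : W} (hab : a ≠ b) :
    IsCompletePairColoring (addTwoColoring T a b) where
  symm := h.addTwoColoring_symm a b
  proper u v u' v' huv huv' heq := by
    rcases hc : addTwoColoring T a b u v with B | w
    · obtain ⟨x, y, rfl, rfl, hB, -⟩ := addTwoColoring_eq_inl hc
      obtain ⟨x', y', rfl, rfl, hB', -⟩ := addTwoColoring_eq_inl (heq.symm.trans hc)
      have h1 : x' ∈ steinerBlock T x y := by rw [hB, ← hB']; simp [steinerBlock]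
      have h2 : y' ∈ steinerBlock T x y := by rw [hB, ← hB']; simp [steinerBlock]
      simp only [steinerBlock, Finset.mem_insert, Finset.mem_singleton] at h1 h2
      grind
    · have h1 := addTwoColoring_eq_inr hab huv hc
      have h2 := addTwoColoring_eq_inr hab huv' (heq.symm.trans hc)
      grind
  complete u v u' v' huv huv' hne := by
    refine (?_ : ∃ c c', c ≠ c' ∧ _ ∧ _).elim fun c hc => hc.elim fun c' hc' =>
      IsCherryCenter.exists_disjoint_pairs (h.addTwoColoring_symm a b) hne hc'.1 hc'.2.1 hc'.2.2
    rcases hc : addTwoColoring T a b u v with B | w <;>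
      rcases hc' : addTwoColoring T a b u' v' with B' | w'
    · obtain ⟨x, y, rfl, rfl, rfl, hB⟩ := addTwoColoring_eq_inl hc
      obtain ⟨x', y', rfl, rfl, rfl, hB'⟩ := addTwoColoring_eq_inl hc'
      rw [hc, hc'] at hne
      have hxy : x ≠ y := fun he => huv (he ▸ rfl)
      have hxy' : x' ≠ y' := fun he => huv' (he ▸ rfl)
      -- Only distinct points of the two blocks are needed; the avoided point `x` is arbitrary.
      obtain ⟨p, -, q, -, -, -, hpq, -, -, -, -, -, -, -, hp, -, hq, -⟩ :=
        h.exists_disjoint_pairs_avoiding x hxy hxy' fun he => hne (congrArg _ he)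
      exact ⟨.inl p, .inl q, by simpa using hpq, h.addTwoColoring_center_inl hxy hB hp,
        h.addTwoColoring_center_inl hxy' hB' hq⟩
    · obtain ⟨x, y, rfl, rfl, rfl, hB⟩ := addTwoColoring_eq_inl hc
      have hxy : x ≠ y := fun he => huv (he ▸ rfl)
      by_cases hw : .inl x = w'
      · exact ⟨.inl y, w', by rw [← hw]; simpa using hxy.symm,
          h.addTwoColoring_center_inl hxy hB (by simp [steinerBlock]),
          h.addTwoColoring_center_inr hab w'⟩
      · exact ⟨.inl x, w', hw, h.addTwoColoring_center_inl hxy hB (by simp [steinerBlock]),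
          h.addTwoColoring_center_inr hab w'⟩
    · obtain ⟨x, y, rfl, rfl, rfl, hB⟩ := addTwoColoring_eq_inl hc'
      have hxy : x ≠ y := fun he => huv' (he ▸ rfl)
      by_cases hw : w = .inl x
      · exact ⟨w, .inl y, by rw [hw]; simpa using hxy, h.addTwoColoring_center_inr hab w,
          h.addTwoColoring_center_inl hxy hB (by simp [steinerBlock])⟩
      · exact ⟨w, .inl x, hw, h.addTwoColoring_center_inr hab w,
          h.addTwoColoring_center_inl hxy hB (by simp [steinerBlock])⟩
    · exact ⟨w, w', fun he => hne (by rw [hc, hc', he]), h.addTwoColoring_center_inr hab w,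
        h.addTwoColoring_center_inr hab w'⟩

/-- Adding two points to a nontrivial Steiner triple system on `n` points. -/
theorem isAchromaticNumber_of_card_add_two [Fintype W] (h : IsSteinerOp T) {n : ℕ}
    (hn : Fintype.card W = n) (hn1 : 1 < n) :
    IsAchromaticNumber (kneserGraph (n + 2) 2) ((n + 2 + 1).choose 2 / 3) := by
  obtain ⟨a, b, hab⟩ := Fintype.one_lt_card_iff.1 (hn ▸ hn1)
  refine (h.isCompletePairColoring_addTwoColoring hab).isAchromaticNumber (by simp [hn])
    (((blocks T).erase (steinerBlock T a b)).disjSum Finset.univ) ?_ ?_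
  · rintro (B | w) hB
    · rw [Finset.inl_mem_disjSum, Finset.mem_erase] at hB
      obtain ⟨x, y, hxy, rfl⟩ := mem_blocks.1 hB.2
      exact ⟨.inl x, .inl y, by simpa using hxy, by simp [addTwoColoring, hB.1]⟩
    · obtain ⟨p, -, hp, -, -, hw, -⟩ := h.addTwoColoring_center_inr hab w
      exact ⟨w, p, hp, hw⟩
  -- One block is lost and `n + 2` paths are gained; `n * (n - 1) / 6 - 1 + (n + 2)` is exactly a
  -- third of the binomial coefficient.
  · have h1 := h.card_mul_le
    have h2 : steinerBlock T a b ∈ blocks T := mem_blocks.2 ⟨a, b, hab, rfl⟩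
    have h3 := Finset.card_pos.2 ⟨_, h2⟩
    rw [Finset.card_disjSum, Finset.card_erase_of_mem h2, Finset.card_univ, Fintype.card_sum,
      Fintype.card_bool, hn, Nat.choose_two_right]
    rw [hn] at h1
    obtain ⟨k, rfl⟩ : ∃ k, n = k + 1 := ⟨n - 1, by omega⟩
    simp only [Nat.add_sub_cancel] at *
    have h4 : (k + 1 + 2 + 1) * (k + 1 + 2) = (k + 1) * k + 6 * k + 12 := by ring
    rw [h4]
    omega

end IsSteinerOp

theorem zmod_three_add_three (i : ZMod 3) : i + 1 + 1 + 1 = i := by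
  revert i; decide

/-! ### Steiner triple systems of order `6t + 3` -/

/-- The Bose construction over an abelian group with bijective doubling map `τ`. -/
def boseOp {G : Type*} [AddCommGroup G] [DecidableEq G] (τ : G ≃ G) :
    G × ZMod 3 → G × ZMod 3 → G × ZMod 3
  | (x, i), (y, j) =>
    if i = j then if x = y then (x, i) else (τ.symm (x + y), i + 1)
    else if j = i + 1 then if x = y then (x, i + 1 + 1) else (τ y - x, i)
    else if x = y then (x, j + 1 + 1) else (τ x - y, j)

/-- The blocks are `{(x, 0), (x, 1), (x, 2)}` and, for `x ≠ y`, `{(x, i), (y, i), (z, i + 1)}` with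
`z` the midpoint of `x` and `y`. Since `z` is neither `x` nor `y`, the two kinds share no pair. -/
theorem isSteinerOp_boseOp {G : Type*} [AddCommGroup G] [DecidableEq G] {τ : G ≃ G}
    (hτ : ∀ x, τ x = x + x) : IsSteinerOp (boseOp τ) where
  idem := by simp [boseOp]
  comm := by
    rintro ⟨x, i⟩ ⟨y, j⟩
    have h0 := add_comm x y
    have h1 := zmod_three_add_one_ne
    have h2 := zmod_three_add_one_add_one_ne
    rcases zmod_three_cases i j with rfl | rfl | rfl <;> simp only [boseOp] <;> grind
  invol := by
    rintro ⟨x, i⟩ ⟨y, j⟩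
    have h1 := zmod_three_add_one_ne
    have h2 := zmod_three_add_one_add_one_ne
    have h3 := zmod_three_add_three
    have h4 : ∀ x y, τ.symm x = y ↔ x = y + y := fun x y => by rw [Equiv.symm_apply_eq, hτ]
    have h5 : ∀ x, τ (τ.symm x) = x := τ.apply_symm_apply
    have h6 : ∀ x y, x + x = y + y → x = y := fun x y hxy => by
      rw [← hτ, ← hτ] at hxy
      exact τ.injective hxy
    rcases zmod_three_cases i j with rfl | rfl | rfl
    · by_cases hxy : x = y
      · simp [boseOp, hxy]
      · have h7 : x ≠ τ.symm (x + y) := fun he => by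
          rw [eq_comm, h4] at he
          exact hxy (add_left_cancel he).symm
        simp [boseOp, hxy, h7]
    · by_cases hxy : x = y
      · simp [boseOp, hxy, h1, (h2 _).symm, h3]
      · have h7 : x ≠ τ y - x := fun he => by
          rw [eq_sub_iff_add_eq, hτ] at he
          exact hxy (h6 _ _ he)
        simp [boseOp, hxy, h7]
    · by_cases hxy : x = y
      · simp [boseOp, hxy, h1, (h2 _).symm, h3, (h1 _).symm]
      · have h7 : x ≠ τ x - y := fun he => by
          rw [eq_sub_iff_add_eq, hτ] at he
          exact hxy (add_left_cancel he).symm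
        simp [boseOp, hxy, h1, (h2 _).symm, h7]

theorem exists_isSteinerOp_six_mul_add_three (t : ℕ) :
    ∃ T : ZMod (2 * t + 1) × ZMod 3 → ZMod (2 * t + 1) × ZMod 3 → ZMod (2 * t + 1) × ZMod 3,
      IsSteinerOp T := by
  have hinj : Function.Injective fun x : ZMod (2 * t + 1) => x + x := by
    intro x y hxy
    have h1 : ((2 * t + 1 : ℕ) : ZMod (2 * t + 1)) = 0 := ZMod.natCast_self _
    push_cast at h1
    simp only at hxy
    -- Both `2 * t + 1` and `2 * t` annihilate `x - y`.
    linear_combination (x - y) * h1 - (t : ZMod (2 * t + 1)) * hxy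
  exact ⟨_, isSteinerOp_boseOp
    (τ := Equiv.ofBijective _ (Finite.injective_iff_bijective.1 hinj)) fun _ => rfl⟩

/-! ### Steiner triple systems of order `6t + 1` -/

/-- The third point of the block through `(x, i)` and `(y, i + 1)` in the Skolem construction. -/
def skolemMixed {G : Type*} [AddCommGroup G] [DecidableEq G] (τ : G ≃ G) (x : G) (i : ZMod 3)
    (y : G) : Option (G × ZMod 3) :=
  if τ y - x ≠ x then some (τ y - x, i) else if x = y then some (x, i + 1 + 1) else none

/-- The block through infinity and `(x, i)` in the Skolem construction. -/
def skolemInfty {G : Type*} [AddCommGroup G] (H : G → Prop) [DecidablePred H] (h x : G)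
    (i : ZMod 3) : Option (G × ZMod 3) :=
  if H x then some (x + h, i + 1 + 1) else some (x + h, i + 1)

/-- The Skolem construction over an abelian group `G` with an involution `h` and a transversal `H`
of the subgroup it generates, where `τ` is a permutation of `G` that doubles the elements of `H`. -/
def skolemOp {G : Type*} [AddCommGroup G] [DecidableEq G] (τ : G ≃ G) (H : G → Prop)
    [DecidablePred H] (h : G) :
    Option (G × ZMod 3) → Option (G × ZMod 3) → Option (G × ZMod 3)
  | none, none => none
  | none, some (x, i) => skolemInfty H h x i
  | some (x, i), none => skolemInfty H h x i
  | some (x, i), some (y, j) =>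
    if i = j then if x = y then some (x, i) else some (τ.symm (x + y), i + 1)
    else if j = i + 1 then skolemMixed τ x i y else skolemMixed τ y j x

/-- Put `x ∘ y = τ.symm (x + y)`; then `x ∘ x` is `x` on `H` and `x + h` off `H`. The blocks are
`{(x, i), (y, i), (x ∘ y, i + 1)}` for `x ≠ y`, the vertical triples over `H`, and `{∞, (x, i), (x +
h, i + 1)}` for `x` off `H`, which cover the pairs left over because `∘` is only half idempotent. -/
theorem isSteinerOp_skolemOp {G : Type*} [AddCommGroup G] [DecidableEq G] {τ : G ≃ G}
    {H : G → Prop} [DecidablePred H] {h : G} (hh : h + h = 0) (hH : ∀ x, H (x + h) ↔ ¬ H x)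
    (hτ : ∀ x, H x → τ x = x + x) : IsSteinerOp (skolemOp τ H h) := by
  have h1 := zmod_three_add_one_ne
  have h2 := zmod_three_add_one_add_one_ne
  have h3 := zmod_three_add_three
  have hh' : ∀ x, x + h + h = x := fun x => by rw [add_assoc, hh, add_zero]
  have hτ' : ∀ x, ¬ H x → τ (x + h) = x + x := fun x hx => by
    rw [hτ _ ((hH x).2 hx), add_add_add_comm, hh, add_zero]
  -- The hypothesis says `y = x ∘ x`, the case in which the third point is not on level `i`.
  have hd : ∀ x y, τ y - x = x → (H x ∧ y = x) ∨ (¬ H x ∧ y = x + h) := by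
    intro x y hxy
    rw [sub_eq_iff_eq_add] at hxy
    by_cases hHx : H x
    · rw [← hτ x hHx, τ.injective.eq_iff] at hxy
      exact .inl ⟨hHx, hxy⟩
    · rw [← hτ' x hHx, τ.injective.eq_iff] at hxy
      exact .inr ⟨hHx, hxy⟩
  have mixed_ne : ∀ x i y, τ y - x ≠ x → skolemMixed τ x i y = some (τ y - x, i) :=
    fun x i y hne => if_pos hne
  have mixed_self : ∀ x i, H x → skolemMixed τ x i x = some (x, i + 1 + 1) := by
    intro x i hx
    simp [skolemMixed, hτ x hx]
  have mixed_add : ∀ x i, ¬ H x → skolemMixed τ x i (x + h) = none := by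
    intro x i hx
    have hne : x ≠ x + h := fun he => by
      have := hH x
      rw [← he] at this
      tauto
    rw [skolemMixed, hτ' x hx, if_neg (by simp), if_neg hne]
  have infty_pos : ∀ x i, H x → skolemInfty H h x i = some (x + h, i + 1 + 1) :=
    fun x i hx => if_pos hx
  have infty_neg : ∀ x i, ¬ H x → skolemInfty H h x i = some (x + h, i + 1) :=
    fun x i hx => if_neg hx
  have op_same : ∀ x y i, x ≠ y →
      skolemOp τ H h (some (x, i)) (some (y, i)) = some (τ.symm (x + y), i + 1) := by
    intro x y i hxy
    simp [skolemOp, hxy]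
  have op_up : ∀ x y i,
      skolemOp τ H h (some (x, i)) (some (y, i + 1)) = skolemMixed τ x i y := by
    intro x y i
    simp [skolemOp, (h1 i).symm]
  have op_down : ∀ x y i,
      skolemOp τ H h (some (x, i + 1)) (some (y, i)) = skolemMixed τ y i x := by
    intro x y i
    simp [skolemOp, h1 i, (h2 i).symm]
  have op_down' : ∀ x y i,
      skolemOp τ H h (some (x, i)) (some (y, i + 1 + 1)) = skolemMixed τ y (i + 1 + 1) x := by
    intro x y i
    rw [← op_down, h3]
  refine ⟨?_, ?_, ?_⟩
  · rintro (_ | ⟨x, i⟩) <;> simp [skolemOp]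
  · rintro (_ | ⟨x, i⟩) (_ | ⟨y, j⟩) <;> try rfl
    rcases zmod_three_cases i j with rfl | rfl | rfl
    · simp only [skolemOp, add_comm x y]
      grind
    · rw [op_up, op_down]
    · rw [op_up, op_down]
  · rintro (_ | ⟨x, i⟩) (_ | ⟨y, j⟩)
    · rfl
    · by_cases hHy : H y <;> simp [skolemOp, skolemInfty, *]
    · by_cases hHx : H x
      · have hHx' : ¬ H (x + h) := fun he => (hH x).1 he hHx
        have h4 := mixed_add (x + h) (i + 1 + 1) hHx'
        rw [hh'] at h4
        rw [show skolemOp τ H h (some (x, i)) none = _ from infty_pos x i hHx, op_down', h4]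
      · rw [show skolemOp τ H h (some (x, i)) none = _ from infty_neg x i hHx, op_up,
          mixed_add x i hHx]
    · rcases zmod_three_cases i j with rfl | rfl | rfl
      · by_cases hxy : x = y
        · simp [skolemOp, hxy]
        · rw [op_same x y j hxy, op_up, mixed_ne] <;>
            rw [τ.apply_symm_apply, add_sub_cancel_left]
          exact fun he => hxy he.symm
      · rw [op_up]
        by_cases hne : τ y - x = x
        · rcases hd x y hne with ⟨hHx, rfl⟩ | ⟨hHx, rfl⟩
          · rw [mixed_self y i hHx, op_down', mixed_self y _ hHx, h3]
          · rw [mixed_add x i hHx]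
            exact infty_neg x i hHx
        · rw [mixed_ne x i y hne, op_same _ _ _ (Ne.symm hne), add_sub_cancel,
            τ.symm_apply_apply]
      · rw [op_down]
        by_cases hne : τ x - y = y
        · rcases hd y x hne with ⟨hHy, rfl⟩ | ⟨hHy, rfl⟩
          · rw [mixed_self x j hHy, op_up, mixed_self x _ hHy, h3]
          · rw [mixed_add y j hHy]
            refine (infty_pos (y + h) (j + 1) ((hH y).2 hHy)).trans ?_
            rw [hh', h3]
        · rw [mixed_ne y j x hne, op_down, mixed_ne, sub_sub_cancel]
          rw [sub_sub_cancel]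
          exact Ne.symm hne

theorem exists_isSteinerOp_six_mul_add_one (t : ℕ) (ht : t ≠ 0) :
    ∃ T : Option (ZMod (2 * t) × ZMod 3) → Option (ZMod (2 * t) × ZMod 3) →
      Option (ZMod (2 * t) × ZMod 3), IsSteinerOp T := by
  have : NeZero (2 * t) := ⟨by omega⟩
  -- Doubling maps each half of the group bijectively onto the even residues; the shift by 1 sends
  -- the upper half to the odd ones.
  let f : ZMod (2 * t) → ZMod (2 * t) := fun x => if x.val < t then x + x else x + x + 1
  have hdouble : ∀ x y : ZMod (2 * t), x + x = y + y → (x.val < t ↔ y.val < t) → x = y := by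
    intro x y hxy hlt
    have hx := x.val_lt
    have hy := y.val_lt
    have h1 : ((x.val + x.val : ℕ) : ZMod (2 * t)) = ((y.val + y.val : ℕ) : ZMod (2 * t)) := by
      simpa using hxy
    rw [ZMod.natCast_eq_natCast_iff] at h1
    obtain ⟨k, hk⟩ := h1.dvd
    push_cast at hk
    -- Equal doubles differ by a multiple of `t`, but two elements of the same half differ by less
    -- than `t`.
    have hk' : (y.val : ℤ) - x.val = t * k := by linarith
    have h0 : (y.val : ℤ) - x.val = 0 := by
      apply Int.eq_zero_of_abs_lt_dvd (m := t) ⟨k, hk'⟩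
      rw [abs_lt]
      omega
    apply ZMod.val_injective
    omega
  have hparity : ∀ x y : ZMod (2 * t), x + x ≠ y + y + 1 := by
    intro x y hxy
    have h1 := congrArg (ZMod.castHom (dvd_mul_right 2 t) (ZMod 2)) hxy
    simp only [map_add, map_one] at h1
    generalize ZMod.castHom (dvd_mul_right 2 t) (ZMod 2) x = a at h1
    generalize ZMod.castHom (dvd_mul_right 2 t) (ZMod 2) y = b at h1
    revert a b
    decide
  have hinj : Function.Injective f := by
    intro x y hxy
    by_cases hx : x.val < t <;> by_cases hy : y.val < t <;>
      simp only [f, hx, hy, if_true, if_false] at hxy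
    · exact hdouble x y hxy (by tauto)
    · exact absurd hxy (hparity x y)
    · exact absurd hxy.symm (hparity y x)
    · exact hdouble x y (add_right_cancel hxy) (by tauto)
  refine ⟨_, isSteinerOp_skolemOp
    (τ := Equiv.ofBijective f (Finite.injective_iff_bijective.1 hinj))
    (H := fun x => x.val < t) (h := (t : ZMod (2 * t))) ?_ ?_ ?_⟩
  · rw [← Nat.cast_add, ← two_mul, ZMod.natCast_self]
  · intro x
    have hx := x.val_lt
    rw [ZMod.val_add, ZMod.val_natCast, Nat.mod_eq_of_lt (by omega : t < 2 * t)]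
    by_cases h : x.val < t
    · rw [Nat.mod_eq_of_lt (by omega)]
      omega
    · rw [Nat.mod_eq_sub_mod (by omega), Nat.mod_eq_of_lt (by omega)]
      omega
  · intro x hx
    exact if_pos hx

/-! ### The achromatic number of `K(n, 2)` -/

/-- Three points contain no two disjoint pairs, so the graph has no edges and a complete colouring
has at most one colour; the general formula would give 2. -/
theorem isAchromaticNumber_kneserGraph_three : IsAchromaticNumber (kneserGraph 3 2) 1 := by
  have hno : ∀ x y, ¬ (kneserGraph 3 2).Adj x y := by
    intro x y h
    have := Finset.card_union_of_disjoint h.2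
    rw [x.2, y.2] at this
    have := Finset.card_le_univ (x.1 ∪ y.1)
    simp at this
    omega
  refine ⟨⟨SimpleGraph.Coloring.mk (fun _ => 0) fun {x y} h => (hno x y h).elim, ?_, ?_⟩, ?_⟩
  · intro i
    exact ⟨⟨{0, 1}, rfl⟩, Subsingleton.elim _ _⟩
  · intro i j hij
    exact (hij (Subsingleton.elim _ _)).elim
  · rintro l ⟨c, -, hc⟩
    by_contra! hl
    obtain ⟨x, y, hxy, -⟩ := hc ⟨0, by omega⟩ ⟨1, hl⟩ (by simp)
    exact hno x y hxy

theorem isAchromaticNumber_kneserGraph_of_le_one {n : ℕ} (hn : n ≤ 1) :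
    IsAchromaticNumber (kneserGraph n 2) ((n + 1).choose 2 / 3) := by
  have hsub : Subsingleton (Fin n) := Fin.subsingleton_iff_le_one.2 hn
  have h : IsCompletePairColoring fun _ _ : Fin n => () :=
    { symm := fun _ _ => rfl
      proper := fun x y _ _ hxy => (hxy (Subsingleton.elim x y)).elim
      complete := fun x y _ _ hxy => (hxy (Subsingleton.elim x y)).elim }
  refine h.isAchromaticNumber (Fintype.card_fin n) ∅ (by simp) ?_
  interval_cases n <;> decide

theorem isAchromaticNumber_kneserGraph_two {n : ℕ} (hn : n ≠ 3) :
    IsAchromaticNumber (kneserGraph n 2) ((n + 1).choose 2 / 3) := by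
  rcases le_or_gt n 1 with h1 | h1
  · exact isAchromaticNumber_kneserGraph_of_le_one h1
  by_cases h3 : n % 3 = 1
  · obtain ⟨m, rfl⟩ : ∃ m, n = 3 * m + 1 := ⟨n / 3, by omega⟩
    exact isAchromaticNumber_kneserGraph_of_mod_three (by omega)
  rcases (by omega : n % 6 = 0 ∨ n % 6 = 2 ∨ n % 6 = 3 ∨ n % 6 = 5) with h | h | h | h
  · obtain ⟨t, rfl⟩ : ∃ t, n = 6 * t := ⟨n / 6, by omega⟩
    have : NeZero (2 * t) := ⟨by omega⟩
    obtain ⟨T, hT⟩ := exists_isSteinerOp_six_mul_add_one t (by omega)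
    refine hT.isAchromaticNumber_of_card_succ ?_
    rw [Fintype.card_option, Fintype.card_prod, ZMod.card, ZMod.card]
    omega
  · obtain ⟨t, rfl⟩ : ∃ t, n = 6 * t + 2 := ⟨n / 6, by omega⟩
    obtain ⟨T, hT⟩ := exists_isSteinerOp_six_mul_add_three t
    refine hT.isAchromaticNumber_of_card_succ ?_
    rw [Fintype.card_prod, ZMod.card, ZMod.card]
    omega
  · obtain ⟨t, rfl⟩ : ∃ t, n = 6 * t + 1 + 2 := ⟨n / 6, by omega⟩
    have : NeZero (2 * t) := ⟨by omega⟩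
    -- `t ≠ 0` comes from `n ≠ 3`: a one-point system has no block to rearrange.
    obtain ⟨T, hT⟩ := exists_isSteinerOp_six_mul_add_one t (by omega)
    refine hT.isAchromaticNumber_of_card_add_two ?_ (by omega)
    rw [Fintype.card_option, Fintype.card_prod, ZMod.card, ZMod.card]
    omega
  · obtain ⟨t, rfl⟩ : ∃ t, n = 6 * t + 3 + 2 := ⟨n / 6, by omega⟩
    obtain ⟨T, hT⟩ := exists_isSteinerOp_six_mul_add_three t
    refine hT.isAchromaticNumber_of_card_add_two ?_ (by omega)
    rw [Fintype.card_prod, ZMod.card, ZMod.card]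
    omega

theorem theorem1 :
    (∀ n : ℕ, n ≠ 3 → IsAchromaticNumber (kneserGraph n 2) (Nat.choose (n + 1) 2 / 3)) ∧
      IsAchromaticNumber (kneserGraph 3 2) 1 := by
  exact ⟨fun _ hn => isAchromaticNumber_kneserGraph_two hn, isAchromaticNumber_kneserGraph_three⟩
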